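/- Let $n\ge 1$ be an integer, let $0<p<1$, and let $\mathbb B_n=\{z\in\mathbb C^n:|z|<1\}$, where $|\cdot|$ is the Euclidean norm. For holomorphic $f:\mathbb B_n\to\mathbb C$ with complex partial derivatives $D_jf$, write $\nabla f=(D_1f,\dots,D_nf)$ and $\mathfrak Rf(z)=\sum_{j=1}^n z_jD_jf(z)$. Let $\mathcal B^{1-p}(\mathbb B_n)$ be the set of holomorphic $f:\mathbb B_n\to\mathbb C$ for which $(1-|z|^2)^{1-p}|\nabla f(z)|$ is bounded on $\mathbb B_n$, and let $\mathcal L_p(\mathbb B_n)$ be the set of holomorphic $f:\mathbb B_n\to\mathbb C$ for which there is $C>0$ with $|f(z)-f(w)|\le C|z-w|^p$ for all $z,w\in\mathbb B_n$. Put $$\|f\|_{\mathcal B^{1-p}}=|f(0)|+\sup_{z\in\mathbb B_n}(1-|z|^2)^{1-p}|\nabla f(z)|,\qquad \|f\|^{\mathfrak R}_{\mathcal B^{1-p}}=|f(0)|+\sup_{z\in\mathbb B_n}(1-|z|^2)^{1-p}|\mathfrak Rf(z)|,$$ $$\|f\|_{\mathcal L_p}=|f(0)|+\sup_{z,w\in\mathbb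 B_n,\ z\ne w}\frac{|f(z)-f(w)|}{|z-w|^p}.$$ Then $\mathcal B^{1-p}(\mathbb B_n)=\mathcal L_p(\mathbb B_n)$. Moreover, for $f\in\mathcal L_p(\mathbb B_n)$ the three quantities are finite and $$\|f\|_{\mathcal B^{1-p}}\asymp\|f\|^{\mathfrak R}_{\mathcal B^{1-p}}\asymp\|f\|_{\mathcal L_p},$$ where $N_1\asymp N_2$ means that there is a constant $C>0$, which may depend on $n$ and $p$ but not on $f$, such that $N_1(f)\le C\,N_2(f)$ and $N_2(f)\le C\,N_1(f)$ for all $f\in\mathcal L_p(\mathbb B_n)$. -/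

import Mathlib

open scoped ENNReal NNReal

noncomputable section

namespace BlochLipschitz

/-- Complex `n`-space with its Euclidean norm. -/
abbrev Cn (n : ℕ) : Type := EuclideanSpace ℂ (Fin n)

/-- The open unit ball of complex `n`-space. -/
def unitBall (n : ℕ) : Set (Cn n) := Metric.ball 0 1

/-- `f` is holomorphic on the open unit ball. A function on the ball is represented by a function on
the whole space; its values outside the ball play no role in any of the notions below. -/
def IsHolo {n : ℕ} (f : Cn n → ℂ) : Prop := DifferentiableOn ℂ f (unitBall n)

/-- The complex partial derivative `D_j f (z)`, the limit as the complex number `t` tends to `0` of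
`(f (z + t e_j) - f z) / t`. -/
def partialD {n : ℕ} (j : Fin n) (f : Cn n → ℂ) (z : Cn n) : ℂ :=
  lineDeriv ℂ f z (EuclideanSpace.single j (1 : ℂ))

/-- The complex gradient `(D_1 f (z), …, D_n f (z))`. -/
def grad {n : ℕ} (f : Cn n → ℂ) (z : Cn n) : Cn n :=
  WithLp.toLp 2 (fun j => partialD j f z)

/-- The radial derivative `∑ z_j D_j f (z)`. -/
def radial {n : ℕ} (f : Cn n → ℂ) (z : Cn n) : ℂ :=
  ∑ j, z j * partialD j f z

/-- The `q`-Bloch space of the unit ball. -/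
def blochSpace (n : ℕ) (q : ℝ) : Set (Cn n → ℂ) :=
  {f | IsHolo f ∧ ∃ M : ℝ, 0 ≤ M ∧ ∀ z ∈ unitBall n, (1 - ‖z‖ ^ 2) ^ q * ‖grad f z‖ ≤ M}

/-- The holomorphic `p`-Lipschitz space of the unit ball. -/
def lipSpace (n : ℕ) (p : ℝ) : Set (Cn n → ℂ) :=
  {f | IsHolo f ∧ ∃ C : ℝ, 0 < C ∧
    ∀ z ∈ unitBall n, ∀ w ∈ unitBall n, ‖f z - f w‖ ≤ C * ‖z - w‖ ^ p}

/-- `|f(0)| + sup (1 - |z|²)^q |∇f(z)|`, the supremum being taken in `[0, ∞]`. -/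
def blochNorm {n : ℕ} (q : ℝ) (f : Cn n → ℂ) : ℝ≥0∞ :=
  ENNReal.ofReal ‖f 0‖ + ⨆ z ∈ unitBall n, ENNReal.ofReal ((1 - ‖z‖ ^ 2) ^ q * ‖grad f z‖)

/-- `|f(0)| + sup (1 - |z|²)^q |(Rf)(z)|`, the supremum being taken in `[0, ∞]`. -/
def radialBlochNorm {n : ℕ} (q : ℝ) (f : Cn n → ℂ) : ℝ≥0∞ :=
  ENNReal.ofReal ‖f 0‖ + ⨆ z ∈ unitBall n, ENNReal.ofReal ((1 - ‖z‖ ^ 2) ^ q * ‖radial f z‖)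

/-- `|f(0)| + sup |f(z) - f(w)| / |z - w|^p` over distinct points `z, w` of the ball, the supremum
being taken in `[0, ∞]`. -/
def lipNorm {n : ℕ} (p : ℝ) (f : Cn n → ℂ) : ℝ≥0∞ :=
  ENNReal.ofReal ‖f 0‖ + ⨆ z ∈ unitBall n, ⨆ w ∈ unitBall n, ⨆ _ : z ≠ w,
    ENNReal.ofReal (‖f z - f w‖ / ‖z - w‖ ^ p)

/-- The two quantities are comparable as `f` varies through `S`: each is at most a constant,
independent of `f`, times the other. -/
def ComparableOn {X : Type*} (S : Set X) (N₁ N₂ : X → ℝ≥0∞) : Prop :=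
  ∃ C : ℝ≥0, 0 < C ∧ ∀ f ∈ S, N₁ f ≤ C * N₂ f ∧ N₂ f ≤ C * N₁ f

end BlochLipschitz

end

namespace BlochLipschitz

open scoped ENNReal NNReal
open Metric Set Filter Topology

variable {n : ℕ}

/-! The norms are compared in a cycle: radial ≤ Bloch ≤ 2 · Lipschitz ≤ C · radial. The first
inequality is Cauchy–Schwarz, the second Cauchy's estimate on the ball of radius 1 - |z| about z.
For the last, two points at distance d are scaled by r = 1 - A d. The radial displacements cost
O(d^p), by integrating the radial derivative. Between the scaled points the full gradient is not
controlled, so Schwarz's lemma is applied on a ball of radius A d with an a priori Hölder constant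
K; it gives A^(p-1) K = K/2 (`LipBound.halve`), and iteration eliminates K. This presupposes that f
is Lipschitz, so Bloch functions are shown to be Lipschitz separately, with the mean value
inequality between the scaled points (`GradBound.lipBound`). -/

lemma mem_unitBall {z : Cn n} : z ∈ unitBall n ↔ ‖z‖ < 1 := by
  simp [unitBall]

lemma IsHolo.differentiableAt {f : Cn n → ℂ} (hf : IsHolo f) {z : Cn n} (hz : ‖z‖ < 1) :
    DifferentiableAt ℂ f z :=
  DifferentiableOn.differentiableAt hf (isOpen_ball.mem_nhds (mem_unitBall.2 hz))

/-! ### Gradient and radial derivative through the Fréchet derivative -/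

lemma fderiv_apply_eq_sum {f : Cn n → ℂ} {z : Cn n} (hf : DifferentiableAt ℂ f z) (v : Cn n) :
    fderiv ℂ f z v = ∑ j, v j * partialD j f z := by
  have hv : v = ∑ j, v j • EuclideanSpace.single j (1 : ℂ) := by
    ext i
    simp [Pi.single_apply]
  conv_lhs => rw [hv]
  simp [partialD, hf.lineDeriv_eq_fderiv]

lemma radial_eq_fderiv {f : Cn n → ℂ} {z : Cn n} (hf : DifferentiableAt ℂ f z) :
    radial f z = fderiv ℂ f z z :=
  (fderiv_apply_eq_sum hf z).symm

/-- The Euclidean norm of the complex gradient is the operator norm of the derivative. -/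
lemma norm_fderiv_eq_norm_grad {f : Cn n → ℂ} {z : Cn n} (hf : DifferentiableAt ℂ f z) :
    ‖fderiv ℂ f z‖ = ‖grad f z‖ := by
  have key : ∀ v : Cn n,
      fderiv ℂ f z v = inner ℂ (WithLp.toLp 2 fun j => star (partialD j f z) : Cn n) v := by
    intro v
    rw [fderiv_apply_eq_sum hf]
    simp [PiLp.inner_apply]
  have hD : fderiv ℂ f z
      = innerSL ℂ (WithLp.toLp 2 fun j => star (partialD j f z) : Cn n) := by
    ext1 v
    exact key v
  rw [hD, innerSL_apply_norm, EuclideanSpace.norm_eq, EuclideanSpace.norm_eq]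
  simp [grad]

lemma IsHolo.norm_radial_le_norm_grad {f : Cn n → ℂ} (hf : IsHolo f) {z : Cn n} (hz : ‖z‖ < 1) :
    ‖radial f z‖ ≤ ‖grad f z‖ := by
  have hd := hf.differentiableAt hz
  rw [radial_eq_fderiv hd, ← norm_fderiv_eq_norm_grad hd]
  exact (ContinuousLinearMap.le_opNorm _ _).trans
    (mul_le_of_le_one_right (norm_nonneg _) hz.le)

/-- `M` bounds the weighted gradient `(1 - |z|²)^q |∇f(z)|` on the ball. -/
def GradBound (q M : ℝ) (f : Cn n → ℂ) : Prop :=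
  ∀ z ∈ unitBall n, (1 - ‖z‖ ^ 2) ^ q * ‖grad f z‖ ≤ M

/-- `R` bounds the weighted radial derivative `(1 - |z|²)^q |(Rf)(z)|` on the ball. -/
def RadialBound (q R : ℝ) (f : Cn n → ℂ) : Prop :=
  ∀ z ∈ unitBall n, (1 - ‖z‖ ^ 2) ^ q * ‖radial f z‖ ≤ R

/-- `f` is Hölder continuous on the ball with exponent `p` and constant `K`. -/
def LipBound (p K : ℝ) (f : Cn n → ℂ) : Prop :=
  ∀ z ∈ unitBall n, ∀ w ∈ unitBall n, ‖f z - f w‖ ≤ K * ‖z - w‖ ^ p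

lemma one_sub_sq_pos {s : ℝ} (h0 : 0 ≤ s) (h1 : s < 1) : 0 < 1 - s ^ 2 := by
  nlinarith

lemma GradBound.nonneg {q M : ℝ} {f : Cn n → ℂ} (h : GradBound q M f) : 0 ≤ M :=
  le_trans (by simp) (h 0 (by simp [unitBall]))

lemma RadialBound.nonneg {q M : ℝ} {f : Cn n → ℂ} (h : RadialBound q M f) : 0 ≤ M :=
  le_trans (by simp) (h 0 (by simp [unitBall]))

lemma GradBound.radialBound {q M : ℝ} {f : Cn n → ℂ} (hf : IsHolo f) (h : GradBound q M f) :
    RadialBound q M f := by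
  intro z hz
  have hz1 := mem_unitBall.1 hz
  refine le_trans ?_ (h z hz)
  have hpos := one_sub_sq_pos (norm_nonneg z) hz1
  gcongr
  exact hf.norm_radial_le_norm_grad hz1

/-- A bound with weight `(1 - s²)^(1-p)` gives a bound by `(1 - t)^(p-1)` for every `t ≥ s`. -/
lemma le_mul_rpow_of_weighted {p M s t x : ℝ} (hp1 : p < 1) (hs : 0 ≤ s) (hst : s ≤ t)
    (ht : t < 1) (hx : 0 ≤ x) (h : (1 - s ^ 2) ^ (1 - p) * x ≤ M) : x ≤ M * (1 - t) ^ (p - 1) := by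
  have h1 : 0 < 1 - t := by linarith
  have h2 : (1 - t) ^ (1 - p) ≤ (1 - s ^ 2) ^ (1 - p) :=
    Real.rpow_le_rpow h1.le (by nlinarith) (by linarith)
  have h3 : (1 - t) ^ (p - 1) = ((1 - t) ^ (1 - p))⁻¹ := by
    rw [← Real.rpow_neg h1.le]; ring_nf
  rw [h3, ← div_eq_mul_inv, le_div_iff₀ (by positivity), mul_comm]
  exact (mul_le_mul_of_nonneg_right h2 hx).trans h

/-- Cauchy's estimate on the largest ball about z, where f varies by at most K (1 - |z|)^p. The
factor 2 comes from 1 - |z|² ≤ 2 (1 - |z|). -/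
lemma LipBound.gradBound {p K : ℝ} (hp0 : 0 < p) (hp1 : p < 1) {f : Cn n → ℂ} (hf : IsHolo f)
    (hK : 0 ≤ K) (h : LipBound p K f) : GradBound (1 - p) (2 * K) f := by
  intro z hz
  have hz1 := mem_unitBall.1 hz
  have hδ : 0 < 1 - ‖z‖ := by linarith
  have hsub : ball z (1 - ‖z‖) ⊆ unitBall n :=
    ball_subset_ball' (by simp [dist_zero_right])
  have hmaps : MapsTo f (ball z (1 - ‖z‖)) (closedBall (f z) (K * (1 - ‖z‖) ^ p)) := by
    intro w hw
    rw [mem_closedBall, dist_eq_norm]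
    refine (h w (hsub hw) z hz).trans ?_
    rw [mem_ball, dist_eq_norm] at hw
    gcongr
  have hD := Complex.norm_fderiv_le_div_of_mapsTo_ball (DifferentiableOn.mono hf hsub) hmaps hδ
  rw [norm_fderiv_eq_norm_grad (hf.differentiableAt hz1)] at hD
  have hw : (1 - ‖z‖ ^ 2) ^ (1 - p) ≤ 2 * (1 - ‖z‖) ^ (1 - p) := by
    calc (1 - ‖z‖ ^ 2) ^ (1 - p) ≤ (2 * (1 - ‖z‖)) ^ (1 - p) :=
          Real.rpow_le_rpow (one_sub_sq_pos (norm_nonneg z) hz1).le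
            (by nlinarith [norm_nonneg z]) (by linarith)
      _ = 2 ^ (1 - p) * (1 - ‖z‖) ^ (1 - p) := Real.mul_rpow (by norm_num) hδ.le
      _ ≤ 2 ^ (1 : ℝ) * (1 - ‖z‖) ^ (1 - p) := by
          gcongr
          · norm_num
          · linarith
      _ = _ := by norm_num
  calc (1 - ‖z‖ ^ 2) ^ (1 - p) * ‖grad f z‖
      ≤ (2 * (1 - ‖z‖) ^ (1 - p)) * (K * (1 - ‖z‖) ^ p / (1 - ‖z‖)) := by gcongr
    _ = 2 * K * ((1 - ‖z‖) ^ (1 - p) * (1 - ‖z‖) ^ p / (1 - ‖z‖)) := by ring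
    _ = 2 * K := by
        rw [← Real.rpow_add hδ]
        simp [hδ.ne']

/-! ### Integration along radii -/

/-- The derivative of a slice `λ ↦ f (λ z)` along the radius is controlled by the radial
derivative, also near the origin. -/
lemma RadialBound.norm_fderiv_smul_le {p R : ℝ} (hp0 : 0 < p) (hp1 : p < 1) {f : Cn n → ℂ}
    (hf : IsHolo f) (h : RadialBound (1 - p) R f) {z : Cn n} (hz : ‖z‖ < 1) {t : ℝ} (ht0 : 0 ≤ t)
    (ht1 : t < 1) : ‖fderiv ℂ f ((t : ℂ) • z) z‖ ≤ 4 * R * (1 - t) ^ (p - 1) := by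
  have hR := h.nonneg
  have hmem : ∀ μ : ℂ, ‖μ‖ ≤ 1 → ‖μ • z‖ < 1 := by
    intro μ hμ
    rw [norm_smul]
    nlinarith [norm_nonneg z, norm_nonneg μ]
  -- The radial derivative at μz is μ times the slice derivative; dividing by |μ| ≥ 1/2 costs the
  -- factor 2.
  have houter : ∀ μ : ℂ, 1 / 2 ≤ ‖μ‖ → ‖μ‖ < 1 →
      ‖fderiv ℂ f (μ • z) z‖ ≤ 2 * R * (1 - ‖μ‖) ^ (p - 1) := by
    intro μ h0 h1
    have hb := h (μ • z) (mem_unitBall.2 (hmem μ h1.le))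
    have hb' := le_mul_rpow_of_weighted hp1 (norm_nonneg _)
      (by rw [norm_smul]; exact mul_le_of_le_one_right (norm_nonneg _) hz.le) h1 (norm_nonneg _) hb
    rw [radial_eq_fderiv (hf.differentiableAt (hmem μ h1.le)), map_smul, norm_smul] at hb'
    nlinarith [norm_nonneg (fderiv ℂ f (μ • z) z)]
  rcases le_or_gt (1 / 2) t with h2 | h2
  · have hn : ‖(t : ℂ)‖ = t := by simp [abs_of_nonneg ht0]
    have hb := houter t (by rwa [hn]) (by rwa [hn])
    rw [hn] at hb
    refine hb.trans ?_
    have : 0 ≤ (1 - t) ^ (p - 1) := Real.rpow_nonneg (by linarith) _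
    nlinarith [mul_nonneg hR this]
  · have hd : DifferentiableOn ℂ (fun μ : ℂ => f (μ • z)) (ball 0 1) := by
      intro μ hμ
      have h1 := hf.differentiableAt (hmem μ (by simpa using (mem_ball.1 hμ).le))
      exact (h1.comp μ (by fun_prop)).differentiableWithinAt
    have hderiv : ∀ μ ∈ ball (0 : ℂ) 1,
        deriv (fun μ : ℂ => f (μ • z)) μ = fderiv ℂ f (μ • z) z := by
      intro μ hμ
      have h1 := (hf.differentiableAt (hmem μ (by simpa using (mem_ball.1 hμ).le))).hasFDerivAt
      have h3 : HasDerivAt (fun μ : ℂ => μ • z) z μ := by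
        simpa using (hasDerivAt_id μ).smul_const z
      exact (h1.comp_hasDerivAt μ h3).deriv
    have hd' := (hd.deriv isOpen_ball).congr fun μ hμ => (hderiv μ hμ).symm
    -- Near μ = 0 that division is useless, so the maximum principle carries over the bound on |μ| =
    -- 1/2, which is 2R · 2^(1-p) ≤ 4R.
    have hmax := Complex.norm_le_of_forall_mem_frontier_norm_le
      (isBounded_ball (x := (0 : ℂ)) (r := 1 / 2))
      (DifferentiableOn.diffContOnCl (hd'.mono ?_)) (C := 4 * R) ?_
      (z := (t : ℂ)) (subset_closure ?_)
    · refine hmax.trans (le_mul_of_one_le_right (by positivity) ?_)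
      exact Real.one_le_rpow_of_pos_of_le_one_of_nonpos (by linarith) (by linarith) (by linarith)
    · rw [closure_ball _ (by norm_num)]
      exact closedBall_subset_ball (by norm_num)
    · intro μ hμ
      rw [frontier_ball _ (by norm_num), mem_sphere_zero_iff_norm] at hμ
      refine (houter μ hμ.ge (by linarith)).trans ?_
      rw [hμ]
      have : (1 - 1 / 2 : ℝ) ^ (p - 1) = 2 ^ (1 - p) := by
        rw [show (1 - 1 / 2 : ℝ) = 2⁻¹ by norm_num, Real.inv_rpow (by norm_num),
          ← Real.rpow_neg (by norm_num)]
        ring_nf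
      have h3 : (2 : ℝ) ^ (1 - p) ≤ 2 := by
        simpa using Real.rpow_le_rpow_of_exponent_le (x := 2) (by norm_num)
          (show 1 - p ≤ 1 by linarith)
      rw [this]
      nlinarith
    · simp [abs_of_nonneg ht0]; linarith

lemma norm_smul_lt_one {z : Cn n} (hz : ‖z‖ < 1) {t : ℝ} (ht0 : 0 ≤ t) (ht1 : t ≤ 1) :
    ‖(t : ℂ) • z‖ < 1 := by
  rw [norm_smul, Complex.norm_real, Real.norm_of_nonneg ht0]
  nlinarith [norm_nonneg z]

/-- Radial Hölder estimate from a bound on the radial derivative. -/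
lemma RadialBound.norm_sub_smul_le {p R : ℝ} (hp0 : 0 < p) (hp1 : p < 1) {f : Cn n → ℂ}
    (hf : IsHolo f) (h : RadialBound (1 - p) R f) {z : Cn n} (hz : ‖z‖ < 1) {r : ℝ} (hr0 : 0 ≤ r)
    (hr1 : r ≤ 1) : ‖f z - f ((r : ℂ) • z)‖ ≤ 4 * R / p * (1 - r) ^ p := by
  have hderiv : ∀ t ∈ Icc r 1, HasDerivAt (fun t : ℝ => f ((t : ℂ) • z) - f ((r : ℂ) • z))
      (fderiv ℂ f ((t : ℂ) • z) z) t := by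
    intro t ht
    have h1 := (hf.differentiableAt
      (norm_smul_lt_one hz (hr0.trans ht.1) ht.2)).hasFDerivAt.restrictScalars ℝ
    have h3 : HasDerivAt (fun t : ℝ => (t : ℂ) • z) z t := by
      simpa using (hasDerivAt_id t).ofReal_comp.smul_const z
    exact (h1.comp_hasDerivAt t h3).sub_const _
  -- The derivative of the majorant blows up at t = 1; there only its continuity is needed.
  have hB : ∀ t ∈ Ico r 1, HasDerivAt
      (fun t : ℝ => 4 * R / p * ((1 - r) ^ p - (1 - t) ^ p)) (4 * R * (1 - t) ^ (p - 1)) t := by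
    intro t ht
    have h1 : HasDerivAt (fun t : ℝ => (1 - t) ^ p) (-1 * p * (1 - t) ^ (p - 1)) t :=
      ((hasDerivAt_id t).const_sub 1).rpow_const (Or.inl (by simpa using (sub_pos.2 ht.2).ne'))
    refine ((h1.const_sub ((1 - r) ^ p)).const_mul (4 * R / p)).congr_deriv ?_
    field_simp
  have hcont : Continuous (fun t : ℝ => 4 * R / p * ((1 - r) ^ p - (1 - t) ^ p)) := by
    have : Continuous (fun t : ℝ => (1 - t) ^ p) :=
      (continuous_const.sub continuous_id).rpow_const fun _ => Or.inr hp0.le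
    fun_prop
  have := image_norm_le_of_norm_deriv_right_le_deriv_boundary'
    (fun t ht => (hderiv t ht).continuousAt.continuousWithinAt)
    (fun t ht => (hderiv t (Ico_subset_Icc_self ht)).hasDerivWithinAt) (by simp)
    hcont.continuousOn (fun t ht => (hB t ht).hasDerivWithinAt)
    (fun t ht => h.norm_fderiv_smul_le hp0 hp1 hf hz (hr0.trans ht.1) ht.2)
    (right_mem_Icc.2 hr1)
  simpa [Real.zero_rpow hp0.ne'] using this

/-- Comparison of two values of `f` through their radial projections. -/
lemma RadialBound.norm_sub_le_radial {p R : ℝ} (hp0 : 0 < p) (hp1 : p < 1) {f : Cn n → ℂ}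
    (hf : IsHolo f) (h : RadialBound (1 - p) R f) {z w : Cn n} (hz : ‖z‖ < 1) (hw : ‖w‖ < 1)
    {r : ℝ} (hr0 : 0 ≤ r) (hr1 : r ≤ 1) :
    ‖f z - f w‖ ≤ 8 * R / p * (1 - r) ^ p + ‖f ((r : ℂ) • z) - f ((r : ℂ) • w)‖ := by
  have h1 := h.norm_sub_smul_le hp0 hp1 hf hz hr0 hr1
  have h2 := h.norm_sub_smul_le hp0 hp1 hf hw hr0 hr1
  have h3 : f z - f w = (f z - f ((r : ℂ) • z)) + (f ((r : ℂ) • z) - f ((r : ℂ) • w))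
      - (f w - f ((r : ℂ) • w)) := by ring
  have h4 : 8 * R / p * (1 - r) ^ p = 4 * R / p * (1 - r) ^ p + 4 * R / p * (1 - r) ^ p := by ring
  rw [h3, h4]
  refine (norm_sub_le _ _).trans ?_
  linarith [norm_add_le (f z - f ((r : ℂ) • z)) (f ((r : ℂ) • z) - f ((r : ℂ) • w))]

lemma GradBound.lipBound {p M : ℝ} (hp0 : 0 < p) (hp1 : p < 1) {f : Cn n → ℂ} (hf : IsHolo f)
    (h : GradBound (1 - p) M f) : LipBound p (8 * M / p + 2 * M) f := by
  intro z hz w hw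
  have hM := h.nonneg
  have hz1 := mem_unitBall.1 hz
  have hw1 := mem_unitBall.1 hw
  rcases eq_or_ne z w with rfl | hne
  · simp [Real.zero_rpow hp0.ne']
  have hd0 : 0 < ‖z - w‖ := norm_pos_iff.2 (sub_ne_zero.2 hne)
  have hd2 : ‖z - w‖ < 2 := (norm_sub_le z w).trans_lt (by linarith)
  set d := ‖z - w‖ with hd
  -- Halving d keeps r ≥ 0, since the ball has diameter 2.
  set r : ℝ := 1 - d / 2 with hr
  have hr0 : 0 ≤ r := by linarith
  have hr1 : r < 1 := by linarith
  have hmem : ∀ u : Cn n, ‖u‖ < 1 → (r : ℂ) • u ∈ closedBall (0 : Cn n) r := by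
    intro u hu
    rw [mem_closedBall_zero_iff, norm_smul, Complex.norm_real, Real.norm_of_nonneg hr0]
    exact mul_le_of_le_one_right hr0 hu.le
  have hball : ∀ u ∈ closedBall (0 : Cn n) r, ‖u‖ < 1 := fun u hu =>
    (mem_closedBall_zero_iff.1 hu).trans_lt hr1
  have hmv := (convex_closedBall (0 : Cn n) r).norm_image_sub_le_of_norm_fderiv_le (𝕜 := ℂ)
    (fun u hu => hf.differentiableAt (hball u hu)) (C := M * (1 - r) ^ (p - 1))
    (fun u hu => by
      rw [norm_fderiv_eq_norm_grad (hf.differentiableAt (hball u hu))]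
      exact le_mul_rpow_of_weighted hp1 (norm_nonneg _) (mem_closedBall_zero_iff.1 hu) hr1
        (norm_nonneg _) (h u (mem_unitBall.2 (hball u hu))))
    (hmem w hw1) (hmem z hz1)
  have hrd : ‖(r : ℂ) • z - (r : ℂ) • w‖ ≤ d := by
    rw [← smul_sub, norm_smul, Complex.norm_real, Real.norm_of_nonneg hr0]
    exact mul_le_of_le_one_left hd0.le hr1.le
  have h1r : 1 - r = d / 2 := by ring
  have hpd : (d / 2) ^ p ≤ d ^ p := Real.rpow_le_rpow (by linarith) (by linarith) hp0.le
  have hpow : (d / 2) ^ (p - 1) * d = 2 * (d / 2) ^ p := by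
    rw [Real.rpow_sub_one (by positivity)]
    field_simp
  rw [h1r] at hmv
  calc ‖f z - f w‖
      ≤ 8 * M / p * (1 - r) ^ p + ‖f ((r : ℂ) • z) - f ((r : ℂ) • w)‖ :=
        (h.radialBound hf).norm_sub_le_radial hp0 hp1 hf hz1 hw1 hr0 hr1.le
    _ ≤ 8 * M / p * (d / 2) ^ p + M * (d / 2) ^ (p - 1) * d := by
        rw [h1r]
        gcongr
        exact hmv.trans (by gcongr)
    _ = (8 * M / p + 2 * M) * (d / 2) ^ p := by
        rw [mul_assoc M, hpow]
        ring
    _ ≤ (8 * M / p + 2 * M) * d ^ p := by gcongr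

/-! ### Absorbing the a priori Hölder constant -/

/-- One step of the self-improvement of the Hölder constant: up to a multiple of the radial bound,
the constant may be halved. -/
lemma LipBound.halve {p R K : ℝ} (hp0 : 0 < p) (hp1 : p < 1) {f : Cn n → ℂ} (hf : IsHolo f)
    (hK : 0 ≤ K) (hR : RadialBound (1 - p) R f) (h : LipBound p K f) :
    LipBound p (8 * R / p * ((2 : ℝ) ^ (1 / (1 - p))) ^ p + K / 2) f := by
  intro z hz w hw
  have hR0 := hR.nonneg
  have hz1 := mem_unitBall.1 hz
  have hw1 := mem_unitBall.1 hw
  rcases eq_or_ne z w with rfl | hne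
  · simp [Real.zero_rpow hp0.ne']
  have hd0 : 0 < ‖z - w‖ := norm_pos_iff.2 (sub_ne_zero.2 hne)
  set d := ‖z - w‖ with hd
  -- Chosen so that A^(p-1) = 1/2, the gain from Schwarz's lemma.
  set A : ℝ := 2 ^ (1 / (1 - p)) with hA
  have hA1 : 1 < A := Real.one_lt_rpow (by norm_num) (one_div_pos.2 (by linarith))
  have hA0 : 0 < A := by linarith
  have hAp : A ^ (p - 1) = 1 / 2 := by
    rw [hA, ← Real.rpow_mul (by norm_num),
      show 1 / (1 - p) * (p - 1) = -1 by
        have : 1 - p ≠ 0 := by linarith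
        field_simp
        ring, Real.rpow_neg_one]
    norm_num
  rcases le_or_gt (A * d) 1 with hAd | hAd
  · set r : ℝ := 1 - A * d with hr
    have hr0 : 0 ≤ r := by linarith
    have hAd0 : 0 < A * d := by positivity
    have hr1 : r < 1 := by linarith
    have h1r : 1 - r = A * d := by ring
    have hsub : ball ((r : ℂ) • z) (A * d) ⊆ unitBall n := by
      refine ball_subset_ball' ?_
      rw [dist_zero_right, norm_smul, Complex.norm_real, Real.norm_of_nonneg hr0]
      nlinarith
    have hmaps : MapsTo f (ball ((r : ℂ) • z) (A * d))
        (closedBall (f ((r : ℂ) • z)) (K * (A * d) ^ p)) := by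
      intro u hu
      rw [mem_closedBall, dist_eq_norm]
      refine (h u (hsub hu) _ (mem_unitBall.2 (norm_smul_lt_one hz1 hr0 hr1.le))).trans ?_
      rw [mem_ball, dist_eq_norm] at hu
      gcongr
    have hrd : dist ((r : ℂ) • w) ((r : ℂ) • z) ≤ d := by
      rw [dist_comm, dist_eq_norm, ← smul_sub, norm_smul, Complex.norm_real,
        Real.norm_of_nonneg hr0]
      exact mul_le_of_le_one_left hd0.le hr1.le
    -- A > 1 puts rw inside the ball of radius A d about rz.
    have hS := Complex.dist_le_div_mul_dist_of_mapsTo_ball (DifferentiableOn.mono hf hsub) hmaps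
      (z := (r : ℂ) • w) (mem_ball.2 (hrd.trans_lt (by nlinarith)))
    rw [dist_comm, dist_eq_norm] at hS
    calc ‖f z - f w‖
        ≤ 8 * R / p * (1 - r) ^ p + ‖f ((r : ℂ) • z) - f ((r : ℂ) • w)‖ :=
          hR.norm_sub_le_radial hp0 hp1 hf hz1 hw1 hr0 hr1.le
      _ ≤ 8 * R / p * (A * d) ^ p + K * (A * d) ^ p / (A * d) * d := by
          rw [h1r]
          gcongr
          exact hS.trans (by gcongr)
      _ = (8 * R / p * A ^ p + K * A ^ (p - 1)) * d ^ p := by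
          rw [Real.mul_rpow hA0.le hd0.le, Real.rpow_sub_one hA0.ne']
          field_simp
      _ = (8 * R / p * A ^ p + K / 2) * d ^ p := by
          rw [hAp]
          ring
  -- For distant points, compare both values with f(0), using 1 < (A d)^p.
  · have h0 := hR.norm_sub_le_radial hp0 hp1 hf hz1 hw1 le_rfl zero_le_one
    have h1 : 1 ≤ A ^ p * d ^ p := by
      rw [← Real.mul_rpow hA0.le hd0.le]
      exact Real.one_le_rpow hAd.le hp0.le
    have hC : 0 ≤ 8 * R / p := by positivity
    have hKd : 0 ≤ K / 2 * d ^ p := by positivity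
    simp only [Complex.ofReal_zero, zero_smul, sub_self, norm_zero, sub_zero, Real.one_rpow,
      mul_one, add_zero] at h0
    nlinarith [mul_le_mul_of_nonneg_left h1 hC]

/-- The constant in the estimate of the Hölder seminorm by the radial seminorm. -/
noncomputable def radialLipConst (p : ℝ) : ℝ := 16 / p * ((2 : ℝ) ^ (1 / (1 - p))) ^ p

/-- K only starts the iteration and is absent from the resulting constant. -/
lemma RadialBound.lipBound {p R K : ℝ} (hp0 : 0 < p) (hp1 : p < 1) {f : Cn n → ℂ}
    (hf : IsHolo f) (hK : 0 ≤ K) (h : LipBound p K f) (hR : RadialBound (1 - p) R f) :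
    LipBound p (radialLipConst p * R) f := by
  have hR0 := hR.nonneg
  have hC : 0 ≤ radialLipConst p := by unfold radialLipConst; positivity
  have key : ∀ m : ℕ, LipBound p (radialLipConst p * R + K * (1 / 2) ^ m) f := by
    intro m
    induction m with
    | zero =>
      intro z hz w hw
      refine (h z hz w hw).trans ?_
      gcongr
      simpa using mul_nonneg hC hR0
    | succ m ih =>
      -- `radialLipConst p * R` is the fixed point of the halving step, so only the excess over it
      -- is halved.
      convert ih.halve hp0 hp1 hf (by positivity) hR using 1
      unfold radialLipConst
      ring
  intro z hz w hw
  have hlim : Tendsto (fun m : ℕ => (radialLipConst p * R + K * (1 / 2) ^ m) * ‖z - w‖ ^ p) atTop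
      (𝓝 ((radialLipConst p * R + K * 0) * ‖z - w‖ ^ p)) :=
    (((tendsto_pow_atTop_nhds_zero_of_lt_one (by norm_num) (by norm_num)).const_mul
      K).const_add _).mul_const _
  simpa using ge_of_tendsto' hlim fun m => key m z hz w hw

/-! ### From pointwise bounds to extended norms -/

lemma le_toReal_iSup {X : Type*} {s : Set X} {g : X → ℝ}
    (h : ⨆ x ∈ s, ENNReal.ofReal (g x) ≠ ⊤) {x : X} (hx : x ∈ s) :
    g x ≤ (⨆ x ∈ s, ENNReal.ofReal (g x)).toReal :=
  (ENNReal.ofReal_le_iff_le_toReal h).1 (le_iSup₂ (f := fun x _ => ENNReal.ofReal (g x)) x hx)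

lemma GradBound.blochNorm_le {q M : ℝ} {f : Cn n → ℂ} (h : GradBound q M f) :
    blochNorm q f ≤ ENNReal.ofReal ‖f 0‖ + ENNReal.ofReal M :=
  add_le_add_right (iSup₂_le fun z hz => ENNReal.ofReal_le_ofReal (h z hz)) _

lemma LipBound.lipNorm_le {p K : ℝ} {f : Cn n → ℂ} (h : LipBound p K f) :
    lipNorm p f ≤ ENNReal.ofReal ‖f 0‖ + ENNReal.ofReal K := by
  refine add_le_add_right (iSup₂_le fun z hz => iSup₂_le fun w hw => iSup_le fun hne => ?_) _
  have : 0 < ‖z - w‖ := norm_pos_iff.2 (sub_ne_zero.2 hne)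
  exact ENNReal.ofReal_le_ofReal ((div_le_iff₀ (by positivity)).2 (h z hz w hw))

lemma exists_radialBound {q : ℝ} {f : Cn n → ℂ} (h : radialBlochNorm q f ≠ ⊤) :
    ∃ R, 0 ≤ R ∧ RadialBound q R f ∧
      radialBlochNorm q f = ENNReal.ofReal ‖f 0‖ + ENNReal.ofReal R := by
  have h2 := (ENNReal.add_ne_top.1 h).2
  refine ⟨_, ENNReal.toReal_nonneg, fun z hz => le_toReal_iSup h2 hz, ?_⟩
  rw [ENNReal.ofReal_toReal h2]
  rfl

lemma exists_lipBound {p : ℝ} (hp0 : 0 < p) {f : Cn n → ℂ} (h : lipNorm p f ≠ ⊤) :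
    ∃ K, 0 ≤ K ∧ LipBound p K f ∧ lipNorm p f = ENNReal.ofReal ‖f 0‖ + ENNReal.ofReal K := by
  have h2 := (ENNReal.add_ne_top.1 h).2
  refine ⟨_, ENNReal.toReal_nonneg, fun z hz w hw => ?_, by rw [ENNReal.ofReal_toReal h2]; rfl⟩
  rcases eq_or_ne z w with rfl | hne
  · simp [Real.zero_rpow hp0.ne']
  have hd : 0 < ‖z - w‖ := norm_pos_iff.2 (sub_ne_zero.2 hne)
  rw [← div_le_iff₀ (by positivity)]
  refine (ENNReal.ofReal_le_iff_le_toReal h2).1 ?_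
  exact le_trans (le_trans (le_iSup (fun _ : z ≠ w =>
      ENNReal.ofReal (‖f z - f w‖ / ‖z - w‖ ^ p)) hne)
    (le_iSup₂ (f := fun w (_ : w ∈ unitBall n) => ⨆ _ : z ≠ w,
      ENNReal.ofReal (‖f z - f w‖ / ‖z - w‖ ^ p)) w hw))
    (le_iSup₂ (f := fun z (_ : z ∈ unitBall n) => ⨆ w ∈ unitBall n, ⨆ _ : z ≠ w,
      ENNReal.ofReal (‖f z - f w‖ / ‖z - w‖ ^ p)) z hz)

/-- With c ≥ 1 a seminorm estimate also covers the |f(0)| term. -/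
lemma add_ofReal_mul_le {a : ℝ≥0∞} {c : ℝ≥0} (hc : 1 ≤ c) (N : ℝ) :
    a + ENNReal.ofReal (c * N) ≤ c * (a + ENNReal.ofReal N) := by
  rw [ENNReal.ofReal_mul c.coe_nonneg, ENNReal.ofReal_coe_nnreal, mul_add]
  gcongr
  exact le_mul_of_one_le_left' (by exact_mod_cast hc)

lemma lipNorm_lt_top {p : ℝ} {f : Cn n → ℂ} (hf : f ∈ lipSpace n p) : lipNorm p f < ⊤ := by
  obtain ⟨-, K, -, hK⟩ := hf
  exact (LipBound.lipNorm_le hK).trans_lt (by simp)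

lemma radialBlochNorm_le_blochNorm {q : ℝ} {f : Cn n → ℂ} (hf : IsHolo f) :
    radialBlochNorm q f ≤ blochNorm q f := by
  refine add_le_add_right (iSup₂_mono fun z hz => ENNReal.ofReal_le_ofReal ?_) _
  have hz1 := mem_unitBall.1 hz
  have hpos := one_sub_sq_pos (norm_nonneg z) hz1
  gcongr
  exact hf.norm_radial_le_norm_grad hz1

lemma blochNorm_le_lipNorm {p : ℝ} (hp0 : 0 < p) (hp1 : p < 1) {f : Cn n → ℂ}
    (hf : f ∈ lipSpace n p) : blochNorm (1 - p) f ≤ (2 : ℝ≥0) * lipNorm p f := by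
  obtain ⟨K, hK0, hK, hN⟩ := exists_lipBound hp0 (lipNorm_lt_top hf).ne
  rw [hN]
  exact (hK.gradBound hp0 hp1 hf.1 hK0).blochNorm_le.trans
    (add_ofReal_mul_le (c := 2) (by norm_num) K)

lemma lipNorm_le_radialBlochNorm {p : ℝ} (hp0 : 0 < p) (hp1 : p < 1) {f : Cn n → ℂ}
    (hf : f ∈ lipSpace n p) (hfin : radialBlochNorm (1 - p) f ≠ ⊤) :
    lipNorm p f ≤ (max 1 (radialLipConst p).toNNReal : ℝ≥0) * radialBlochNorm (1 - p) f := by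
  obtain ⟨R, hR0, hR, hN⟩ := exists_radialBound hfin
  obtain ⟨hol, K, hK0, hK⟩ := hf
  rw [hN]
  refine (hR.lipBound hp0 hp1 hol hK0.le hK).lipNorm_le.trans
    (le_trans ?_ (add_ofReal_mul_le (le_max_left _ _) R))
  gcongr
  rw [NNReal.coe_max]
  exact (Real.le_coe_toNNReal _).trans (le_max_right _ _)

theorem blochSpace_eq_lipSpace {p : ℝ} (hp0 : 0 < p) (hp1 : p < 1) :
    blochSpace n (1 - p) = lipSpace n p := by
  ext f
  constructor
  · rintro ⟨hf, M, hM, h⟩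
    -- The added 1 keeps the Lipschitz constant positive when M = 0.
    exact ⟨hf, 8 * M / p + 2 * M + 1, by positivity, fun z hz w hw =>
      (GradBound.lipBound hp0 hp1 hf h z hz w hw).trans 
        (mul_le_mul_of_nonneg_right (by linarith) (by positivity))⟩
  · rintro ⟨hf, K, hK, h⟩
    exact ⟨hf, 2 * K, by positivity, LipBound.gradBound hp0 hp1 hf hK.le h⟩

end BlochLipschitz

theorem theorem3p4 (n : ℕ) (hn : 1 ≤ n) (p : ℝ) (hp0 : 0 < p) (hp1 : p < 1) :
    BlochLipschitz.blochSpace n (1 - p) = BlochLipschitz.lipSpace n p ∧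
    (∀ f ∈ BlochLipschitz.lipSpace n p,
      BlochLipschitz.blochNorm (1 - p) f < ⊤ ∧
      BlochLipschitz.radialBlochNorm (1 - p) f < ⊤ ∧
      BlochLipschitz.lipNorm p f < ⊤) ∧
    BlochLipschitz.ComparableOn (BlochLipschitz.lipSpace n p)
      (BlochLipschitz.blochNorm (1 - p)) (BlochLipschitz.radialBlochNorm (1 - p)) ∧
    BlochLipschitz.ComparableOn (BlochLipschitz.lipSpace n p)
      (BlochLipschitz.radialBlochNorm (1 - p)) (BlochLipschitz.lipNorm p) := by
  have hfin : ∀ f ∈ BlochLipschitz.lipSpace n p,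
      BlochLipschitz.blochNorm (1 - p) f < ⊤ ∧
      BlochLipschitz.radialBlochNorm (1 - p) f < ⊤ ∧
      BlochLipschitz.lipNorm p f < ⊤ := by
    intro f hf
    have hL := BlochLipschitz.lipNorm_lt_top hf
    have hB : BlochLipschitz.blochNorm (1 - p) f < ⊤ :=
      (BlochLipschitz.blochNorm_le_lipNorm hp0 hp1 hf).trans_lt
        (ENNReal.mul_lt_top ENNReal.coe_lt_top hL)
    exact ⟨hB, (BlochLipschitz.radialBlochNorm_le_blochNorm hf.1).trans_lt hB, hL⟩
  obtain ⟨c, hc1, hc⟩ : ∃ c : NNReal, 1 ≤ c ∧ ∀ f ∈ BlochLipschitz.lipSpace n p,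
      BlochLipschitz.lipNorm p f ≤ c * BlochLipschitz.radialBlochNorm (1 - p) f :=
    ⟨_, le_max_left _ _, fun f hf =>
      BlochLipschitz.lipNorm_le_radialBlochNorm hp0 hp1 hf (hfin f hf).2.1.ne⟩
  have h1c : (1 : ENNReal) ≤ ((2 * c : NNReal) : ENNReal) := by
    exact_mod_cast hc1.trans (le_mul_of_one_le_left' (by norm_num))
  refine ⟨BlochLipschitz.blochSpace_eq_lipSpace hp0 hp1, hfin,
    ⟨2 * c, by positivity, fun f hf => ⟨?_, ?_⟩⟩, ⟨2 * c, by positivity, fun f hf => ⟨?_, ?_⟩⟩⟩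
  · rw [ENNReal.coe_mul, mul_assoc]
    exact (BlochLipschitz.blochNorm_le_lipNorm hp0 hp1 hf).trans (by gcongr; exact hc f hf)
  · exact (BlochLipschitz.radialBlochNorm_le_blochNorm hf.1).trans (le_mul_of_one_le_left' h1c)
  · refine ((BlochLipschitz.radialBlochNorm_le_blochNorm hf.1).trans
      (BlochLipschitz.blochNorm_le_lipNorm hp0 hp1 hf)).trans ?_
    gcongr
    exact le_mul_of_one_le_right' hc1
  · refine (hc f hf).trans ?_
    gcongr
    exact le_mul_of_one_le_left' (by norm_num)
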